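/- For a finite simple graph $H$ with $n=v(H)$ vertices, $e(H)$ edges and Laplacian matrix $L(H)=D(H)-A(H)$, let $P(\lambda,H)$ be the polynomial with $\det(\lambda I-L(H))=\lambda P(\lambda,H)$. Define the numbers $c_s(H)$ by $P(\lambda,H)=\sum_{s=0}^{n-1}(-1)^s c_s(H)\lambda^{n-1-s}$, with $c_s(H)=0$ for $s\ge n$. Let $\lambda(H)$ be the largest eigenvalue of $L(H)$, and let $\Phi(\lambda,H)=\lambda^{e(H)-n+1}P(\lambda,H)$. Write $H\succ\succ^{\phi}F$ if $\lambda(H)\le\lambda(F)$ and $\Phi(\lambda,H)>\Phi(\lambda,F)$ for every real $\lambda\ge\lambda(F)$. **Theorem.** Let $M$ be a matching with $m$ edges, that is, a finite simple graph with $m$ edges no two of which share a vertex (isolated vertices are allowed). Let $G$ be a finite simple graph with $m$ edges, on any number of vertices, such that $G$ and $M$ do not become isomorphic when all isolated vertices are removed from both. Then (a) $c_s(M)\ge c_s(G)$ for every $s\ge 0$, and $c_s(M)>c_s(G)$ for every $s\in\{2,\dots,m\}$; (b) $M\succ\succ^{\phi}G$. -/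

import Mathlib

noncomputable section

namespace LapPoset

/-- The Laplacian characteristic polynomial `det (λ I - L(G))`, where `L(G) = D(G) - A(G)`. -/
def lapCharpoly {V : Type*} [Fintype V] [DecidableEq V]
    (G : SimpleGraph V) [DecidableRel G.Adj] : Polynomial ℝ :=
  (G.lapMatrix ℝ).charpoly

/-- The Laplacian polynomial `P(λ, G)`, determined by `det (λ I - L(G)) = λ P(λ, G)`
(see `X_mul_lapPoly`). -/
def lapPoly {V : Type*} [Fintype V] [DecidableEq V]
    (G : SimpleGraph V) [DecidableRel G.Adj] : Polynomial ℝ :=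
  (lapCharpoly G).divX

theorem X_mul_lapPoly {V : Type*} [Fintype V] [DecidableEq V] [Nonempty V]
    (G : SimpleGraph V) [DecidableRel G.Adj] :
    Polynomial.X * lapPoly G = lapCharpoly G := by
  have h : (lapCharpoly G).coeff 0 = 0 := by
    have hd := G.det_lapMatrix_eq_zero
    rw [Matrix.det_eq_sign_charpoly_coeff] at hd
    simpa [lapCharpoly] using hd
  have := Polynomial.X_mul_divX_add (lapCharpoly G)
  rw [h] at this
  simpa [lapPoly] using this

/-- The coefficients `c_s(G)`, given by
`P(λ, G) = ∑_{s = 0}^{n - 1} (-1)^s c_s(G) λ^(n - 1 - s)` with `n = v(G)`,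
and `c_s(G) = 0` for `s ≥ n`. -/
def lapCoeff {V : Type*} [Fintype V] [DecidableEq V]
    (G : SimpleGraph V) [DecidableRel G.Adj] (s : ℕ) : ℝ :=
  if s < Fintype.card V then (-1) ^ s * (lapPoly G).coeff (Fintype.card V - 1 - s) else 0

/-- `Φ(x, G) = x^(m - n + 1) P(x, G)` with `m = e(G)`, `n = v(G)`;
the exponent is an integer that may be negative. -/
def lapPhi {V : Type*} [Fintype V] [DecidableEq V]
    (G : SimpleGraph V) [DecidableRel G.Adj] (x : ℝ) : ℝ :=
  x ^ ((G.edgeFinset.card : ℤ) - (Fintype.card V : ℤ) + 1) * (lapPoly G).eval x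

/-- `λ(G)`, the largest eigenvalue of the Laplacian matrix. -/
def lapMax {V : Type*} [Fintype V] [DecidableEq V]
    (G : SimpleGraph V) [DecidableRel G.Adj] : ℝ :=
  sSup (spectrum ℝ (G.lapMatrix ℝ))

/-- The relation `G ⪰^φ F`. -/
def PhiGE {V W : Type*} [Fintype V] [DecidableEq V] [Fintype W] [DecidableEq W]
    (G : SimpleGraph V) [DecidableRel G.Adj] (F : SimpleGraph W) [DecidableRel F.Adj] : Prop :=
  lapMax G ≤ lapMax F ∧ ∀ x : ℝ, lapMax F ≤ x → lapPhi F x ≤ lapPhi G x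

/-- The relation `G ≻≻^φ F`. -/
def PhiDominates {V W : Type*} [Fintype V] [DecidableEq V] [Fintype W] [DecidableEq W]
    (G : SimpleGraph V) [DecidableRel G.Adj] (F : SimpleGraph W) [DecidableRel F.Adj] : Prop :=
  PhiGE G F ∧ ∀ x : ℝ, lapMax F ≤ x → lapPhi F x < lapPhi G x

/-- `M` is a matching, possibly with additional isolated vertices:
no two distinct edges share a vertex. -/
def IsGraphMatching {V : Type*} (M : SimpleGraph V) : Prop :=
  ∀ e ∈ M.edgeSet, ∀ f ∈ M.edgeSet, ∀ v : V, v ∈ e → v ∈ f → e = f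

/-- The graph obtained from `G` by removing its isolated vertices. -/
def core {V : Type*} (G : SimpleGraph V) : SimpleGraph G.support :=
  G.induce G.support

end LapPoset

end

/-! With `B` the signed incidence matrix, `L = B Bᵀ`, while the edge Laplacian `Bᵀ B` has size `m ×
m`, the same nonzero spectrum and diagonal entries 2. Its eigenvalues `μ` are thus nonnegative with
mean exactly 2, the numbers `c_s` are the elementary symmetric functions of `μ`, and `Φ(x) = ∏ (x -
μ e)`. Off-diagonal entries vanish exactly for disjoint edges, so matchings are the graphs with all
`μ e = 2`.

Everything reduces to extremality of the constant family among families of fixed mean: a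
Maclaurin-type inequality (`esymmPoly.coeff_lt_const`) gives (a), and AM-GM (`prod_sub_lt_pow`)
gives (b). Two matchings of equal size have isomorphic cores, so `G` is not a matching and both are
strict. -/

open Polynomial in
/-- The polynomial `∏ (1 + μ i X)`, whose coefficients are the elementary symmetric functions. -/
noncomputable def esymmPoly {ι : Type*} (s : Finset ι) (μ : ι → ℝ) : ℝ[X] :=
  ∏ i ∈ s, (1 + C (μ i) * X)

/-! ### Elementary symmetric functions of numbers with given mean. -/

namespace esymmPoly
open Polynomial Finset

variable {ι : Type*} {s : Finset ι} {μ : ι → ℝ}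

theorem coeff_one_add_C_mul_X_mul_succ (a : ℝ) (q : ℝ[X]) (k : ℕ) :
    ((1 + C a * X) * q).coeff (k + 1) = q.coeff (k + 1) + a * q.coeff k := by
  rw [add_mul, one_mul, coeff_add, mul_assoc, coeff_C_mul, coeff_X_mul]

theorem coeff_zero_eq_one : (esymmPoly s μ).coeff 0 = 1 := by
  simp [esymmPoly, coeff_zero_eq_eval_zero, eval_prod]

theorem coeff_nonneg (hμ : ∀ i ∈ s, 0 ≤ μ i) (k : ℕ) : 0 ≤ (esymmPoly s μ).coeff k := by
  classical
  induction s using Finset.induction_on generalizing k with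
  | empty => simp only [esymmPoly, prod_empty, coeff_one]; split_ifs <;> simp
  | insert a s ha ih =>
    have hs := ih fun i hi => hμ i (mem_insert_of_mem hi)
    have h : esymmPoly (insert a s) μ = (1 + C (μ a) * X) * esymmPoly s μ := by
      simp [esymmPoly, prod_insert ha]
    cases k with
    | zero => rw [coeff_zero_eq_one]; exact zero_le_one
    | succ k =>
      rw [h, coeff_one_add_C_mul_X_mul_succ]
      exact add_nonneg (hs _) (mul_nonneg (hμ a (mem_insert_self _ _)) (hs _))

theorem coeff_eq_zero {k : ℕ} (hk : #s < k) : (esymmPoly s μ).coeff k = 0 := by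
  refine coeff_eq_zero_of_natDegree_lt (lt_of_le_of_lt (natDegree_prod_le _ _) (lt_of_le_of_lt ?_ hk))
  rw [card_eq_sum_ones]
  refine sum_le_sum fun i _ => ?_
  compute_degree

variable [DecidableEq ι]

theorem eq_mul_erase {i : ι} (hi : i ∈ s) :
    esymmPoly s μ = (1 + C (μ i) * X) * esymmPoly (s.erase i) μ :=
  (mul_prod_erase s (fun i => 1 + C (μ i) * X) hi).symm

/-- Compare coefficients in the derivative of the product. -/
theorem sum_mul_coeff_erase (k : ℕ) :
    ∑ i ∈ s, μ i * (esymmPoly (s.erase i) μ).coeff k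
      = (k + 1) * (esymmPoly s μ).coeff (k + 1) := by
  have h : derivative (esymmPoly s μ) = ∑ i ∈ s, esymmPoly (s.erase i) μ * C (μ i) := by
    rw [esymmPoly, derivative_prod_finset]
    simp [esymmPoly]
  have h' := congrArg (fun p => coeff p k) h
  simp only [coeff_derivative, finsetSum_coeff, coeff_mul_C] at h'
  rw [mul_comm, h']
  exact sum_congr rfl fun i _ => mul_comm _ _

theorem sum_coeff_erase (k : ℕ) :
    ∑ i ∈ s, (esymmPoly (s.erase i) μ).coeff k = (#s - k) * (esymmPoly s μ).coeff k := by
  cases k with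
  | zero => simp [coeff_zero_eq_one]
  | succ k =>
    have h : ∀ i ∈ s, (esymmPoly (s.erase i) μ).coeff (k + 1)
        = (esymmPoly s μ).coeff (k + 1) - μ i * (esymmPoly (s.erase i) μ).coeff k := by
      intro i hi
      rw [eq_mul_erase hi, coeff_one_add_C_mul_X_mul_succ]; ring
    rw [sum_congr rfl h, sum_sub_distrib, sum_mul_coeff_erase, sum_const, nsmul_eq_mul]
    push_cast; ring

/-- Removing `i` and then splitting off `j` leaves `1 + μ j X` times a polynomial symmetric in `i`
and `j`, with nonnegative coefficients; so removing the larger number leaves the smaller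
coefficient. -/
theorem antivaryOn_coeff_erase (hμ : ∀ i ∈ s, 0 ≤ μ i) (k : ℕ) :
    AntivaryOn μ (fun i => (esymmPoly (s.erase i) μ).coeff k) s := by
  intro i hi j hj hij
  by_contra! hlt
  have hne : i ≠ j := fun h => by simp [h] at hij
  refine absurd hij (not_lt.2 ?_)
  cases k with
  | zero => simp [coeff_zero_eq_one]
  | succ k =>
    simp only
    rw [eq_mul_erase (mem_erase.2 ⟨hne.symm, hj⟩), eq_mul_erase (mem_erase.2 ⟨hne, hi⟩),
      erase_right_comm, coeff_one_add_C_mul_X_mul_succ, coeff_one_add_C_mul_X_mul_succ]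
    have := coeff_nonneg (s := (s.erase j).erase i) (μ := μ)
      (fun l hl => hμ l (mem_of_mem_erase (mem_of_mem_erase hl))) k
    rw [erase_right_comm] at this
    gcongr

/-- A weak form of Maclaurin's inequalities: consecutive elementary symmetric functions of
nonnegative numbers with mean `a`. -/
theorem succ_mul_coeff_succ_le (hμ : ∀ i ∈ s, 0 ≤ μ i) {a : ℝ} (ha : ∑ i ∈ s, μ i = #s * a)
    (k : ℕ) :
    (k + 1) * (esymmPoly s μ).coeff (k + 1) ≤ a * ((#s - k) * (esymmPoly s μ).coeff k) := by
  rcases s.eq_empty_or_nonempty with rfl | hs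
  · cases k <;> simp [esymmPoly, coeff_one]
  -- Chebyshev's sum inequality; both sums are known multiples of consecutive coefficients.
  · have h := (antivaryOn_coeff_erase hμ k).card_mul_sum_le_sum_mul_sum
    rw [sum_mul_coeff_erase, sum_coeff_erase, ha, mul_assoc] at h
    exact le_of_mul_le_mul_left h (by exact_mod_cast hs.card_pos)

theorem coeff_const_succ (a : ℝ) (k : ℕ) :
    (k + 1) * (esymmPoly s fun _ => a).coeff (k + 1)
      = a * ((#s - k) * (esymmPoly s fun _ => a).coeff k) := by
  rw [← sum_mul_coeff_erase, ← sum_coeff_erase, mul_sum]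

theorem coeff_le_const (hμ : ∀ i ∈ s, 0 ≤ μ i) {a : ℝ} (h0 : 0 ≤ a) (ha : ∑ i ∈ s, μ i = #s * a)
    (k : ℕ) : (esymmPoly s μ).coeff k ≤ (esymmPoly s fun _ => a).coeff k := by
  induction k with
  | zero => simp [coeff_zero_eq_one]
  | succ k ih =>
    rcases le_or_gt (k + 1) #s with hk | hk
    · refine le_of_mul_le_mul_left ?_ (by positivity : (0 : ℝ) < k + 1)
      refine (succ_mul_coeff_succ_le hμ ha k).trans ?_
      rw [coeff_const_succ]
      have : (0 : ℝ) ≤ #s - k := sub_nonneg.2 (by exact_mod_cast (Nat.le_succ k).trans hk)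
      gcongr
    · rw [coeff_eq_zero hk, coeff_eq_zero hk]

theorem two_mul_coeff_two :
    2 * (esymmPoly s μ).coeff 2 = (∑ i ∈ s, μ i) ^ 2 - ∑ i ∈ s, μ i ^ 2 := by
  have h0 := sum_mul_coeff_erase (s := s) (μ := μ) 0
  have h1 := sum_mul_coeff_erase (s := s) (μ := μ) 1
  have h : ∀ i ∈ s, μ i * (esymmPoly (s.erase i) μ).coeff 1
      = μ i * (esymmPoly s μ).coeff 1 - μ i ^ 2 := by
    intro i hi
    rw [eq_mul_erase hi, coeff_one_add_C_mul_X_mul_succ, coeff_zero_eq_one]; ring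
  rw [sum_congr rfl h, sum_sub_distrib, ← sum_mul] at h1
  simp only [coeff_zero_eq_one, mul_one, Nat.cast_zero, zero_add, one_mul] at h0
  rw [← h0] at h1
  norm_num at h1
  linarith

theorem coeff_lt_const (hμ : ∀ i ∈ s, 0 ≤ μ i) {a : ℝ} (h0 : 0 < a) (ha : ∑ i ∈ s, μ i = #s * a)
    (hne : ∃ i ∈ s, μ i ≠ a) {k : ℕ} (h2 : 2 ≤ k) (hk : k ≤ #s) :
    (esymmPoly s μ).coeff k < (esymmPoly s fun _ => a).coeff k := by
  induction k, h2 using Nat.le_induction with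
  | base =>
    obtain ⟨j, hj, hja⟩ := hne
    have h1 := two_mul_coeff_two (s := s) (μ := μ)
    have h3 := two_mul_coeff_two (s := s) (μ := fun _ => a)
    -- Strictness enters through the variance: with the sum fixed, the degree-two coefficient drops
    -- as the sum of squares grows.
    have h4 : 0 < ∑ i ∈ s, (μ i - a) ^ 2 :=
      sum_pos' (fun i _ => sq_nonneg _) ⟨j, hj, by have := sub_ne_zero.2 hja; positivity⟩
    have h5 : ∑ i ∈ s, (μ i - a) ^ 2 = ∑ i ∈ s, μ i ^ 2 - 2 * a * ∑ i ∈ s, μ i + #s * a ^ 2 := by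
      rw [mul_sum, ← sum_sub_distrib, ← nsmul_eq_mul, ← sum_const, ← sum_add_distrib]
      exact sum_congr rfl fun i _ => by ring
    rw [sum_const, sum_const, nsmul_eq_mul, nsmul_eq_mul] at h3
    rw [ha] at h1 h5
    nlinarith
  | succ k h2 ih =>
    refine lt_of_mul_lt_mul_left (a := (k + 1 : ℝ)) ?_ (by positivity)
    refine (succ_mul_coeff_succ_le hμ ha k).trans_lt ?_
    rw [coeff_const_succ]
    have : (0 : ℝ) < #s - k := sub_pos.2 (by exact_mod_cast hk)
    have := ih (by omega)
    gcongr

end esymmPoly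

open Finset in
/-- Strict AM-GM: if the `μ i ≤ x` have mean `a < x` and are not all equal to `a`. -/
theorem prod_sub_lt_pow {ι : Type*} {s : Finset ι} {μ : ι → ℝ} {a x : ℝ}
    (hx : ∀ i ∈ s, μ i ≤ x) (hax : a < x) (ha : ∑ i ∈ s, μ i = #s * a) (hne : ∃ i ∈ s, μ i ≠ a) :
    ∏ i ∈ s, (x - μ i) < (x - a) ^ #s := by
  have hpos : 0 < x - a := sub_pos.2 hax
  -- A vanishing factor is treated apart, since `prod_lt_prod` needs positive factors.
  by_cases h0 : ∃ i ∈ s, μ i = x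
  · obtain ⟨i, hi, h⟩ := h0
    rw [prod_eq_zero hi (sub_eq_zero.2 h.symm)]
    exact pow_pos hpos _
  · push Not at h0
    -- Uses `1 + t ≤ exp t`, strict for `t ≠ 0`; the exponents sum to zero because `a` is the mean.
    have key : ∏ i ∈ s, (x - μ i) < ∏ i ∈ s, (x - a) * Real.exp ((a - μ i) / (x - a)) := by
      have e : ∀ i, x - μ i = (x - a) * ((a - μ i) / (x - a) + 1) := fun i => by field_simp; ring
      refine prod_lt_prod (fun i hi => sub_pos.2 (lt_of_le_of_ne (hx i hi) (h0 i hi)))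
        (fun i _ => ?_) ?_
      · rw [e]; gcongr; exact Real.add_one_le_exp _
      · obtain ⟨j, hj, hja⟩ := hne
        refine ⟨j, hj, ?_⟩
        rw [e]; gcongr
        exact Real.add_one_lt_exp (div_ne_zero (sub_ne_zero.2 hja.symm) hpos.ne')
    refine key.trans_eq ?_
    rw [prod_mul_distrib, prod_const, ← Real.exp_sum, ← sum_div, sum_sub_distrib, ha]
    simp

/-! ### Incidence matrix, edge Laplacian and its spectrum. -/

namespace SimpleGraph
open Matrix Finset Polynomial

section Incidence

variable {V : Type*} [DecidableEq V] (G : SimpleGraph V)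

/-- The signed incidence matrix of a graph, for an arbitrary orientation of the edges. -/
noncomputable def signedIncMatrix : Matrix V G.edgeSet ℝ := fun v e =>
  (if v = (Quot.out e.1).1 then 1 else 0) - (if v = (Quot.out e.1).2 then 1 else 0)

theorem exists_signedIncMatrix_apply (e : G.edgeSet) :
    ∃ a b, a ≠ b ∧ e.1 = s(a, b) ∧
      ∀ v, G.signedIncMatrix v e = (if v = a then 1 else 0) - (if v = b then 1 else 0) := by
  have h : e.1 = s((Quot.out e.1).1, (Quot.out e.1).2) := (Quot.out_eq e.1).symm
  have hadj : G.Adj (Quot.out e.1).1 (Quot.out e.1).2 := by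
    rw [← mem_edgeSet, ← h]; exact e.2
  exact ⟨_, _, hadj.ne, h, fun v => rfl⟩

variable {G}

theorem signedIncMatrix_mul_self (v : V) (e : G.edgeSet) :
    G.signedIncMatrix v e * G.signedIncMatrix v e = if v ∈ e.1 then 1 else 0 := by
  obtain ⟨a, b, hab, he, h⟩ := G.exists_signedIncMatrix_apply e
  rw [h, he]
  by_cases h1 : v = a <;> by_cases h2 : v = b <;> simp_all

theorem signedIncMatrix_mul_of_ne {v w : V} (hvw : v ≠ w) (e : G.edgeSet) :
    G.signedIncMatrix v e * G.signedIncMatrix w e = if e.1 = s(v, w) then -1 else 0 := by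
  obtain ⟨a, b, hab, he, h⟩ := G.exists_signedIncMatrix_apply e
  rw [h, h, he]
  simp only [Sym2.eq_iff]
  split_ifs <;> grind

theorem signedIncMatrix_mul_conjTranspose [Fintype V] [DecidableRel G.Adj] :
    G.signedIncMatrix * G.signedIncMatrixᴴ = G.lapMatrix ℝ := by
  ext v w
  rw [mul_apply]
  simp only [conjTranspose_apply, star_trivial, lapMatrix, degMatrix, Matrix.sub_apply, adjMatrix_apply]
  by_cases hvw : v = w
  · subst hvw
    simp only [signedIncMatrix_mul_self, diagonal_apply_eq, G.irrefl, if_false, sub_zero]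
    rw [← sum_subtype G.edgeFinset (by simp) (fun e => if v ∈ e then (1 : ℝ) else 0), sum_boole,
      ← incidenceFinset_eq_filter, card_incidenceFinset_eq_degree]
  · simp only [signedIncMatrix_mul_of_ne hvw, diagonal_apply_ne _ hvw, zero_sub]
    rw [← sum_subtype G.edgeFinset (by simp) (fun e => if e = s(v, w) then (-1 : ℝ) else 0),
      sum_ite_eq']
    simp only [mem_edgeFinset, mem_edgeSet]
    split_ifs <;> simp

variable (G) in
/-- The edge Laplacian `Bᴴ B`, where `B` is the signed incidence matrix. -/
noncomputable def edgeLapMatrix [Fintype V] : Matrix G.edgeSet G.edgeSet ℝ :=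
  G.signedIncMatrixᴴ * G.signedIncMatrix

theorem edgeLapMatrix_apply [Fintype V] {e : G.edgeSet} {a b : V}
    (h : ∀ v, G.signedIncMatrix v e = (if v = a then 1 else 0) - (if v = b then 1 else 0))
    (f : G.edgeSet) :
    G.edgeLapMatrix e f = G.signedIncMatrix a f - G.signedIncMatrix b f := by
  simp [edgeLapMatrix, mul_apply, h, sub_mul, sum_sub_distrib]

theorem edgeLapMatrix_apply_self [Fintype V] (e : G.edgeSet) : G.edgeLapMatrix e e = 2 := by
  obtain ⟨a, b, hab, he, h⟩ := G.exists_signedIncMatrix_apply e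
  rw [edgeLapMatrix_apply h, h, h]
  simp [hab, hab.symm]
  norm_num

theorem edgeLapMatrix_apply_eq_zero_iff [Fintype V] {e f : G.edgeSet} (hef : e ≠ f) :
    G.edgeLapMatrix e f = 0 ↔ ∀ v, v ∈ e.1 → v ∉ f.1 := by
  obtain ⟨a, b, hab, he, h⟩ := G.exists_signedIncMatrix_apply e
  obtain ⟨c, d, hcd, hf, h'⟩ := G.exists_signedIncMatrix_apply f
  have hne : s(a, b) ≠ s(c, d) := by rw [← he, ← hf]; exact fun h => hef (Subtype.ext h)
  rw [edgeLapMatrix_apply h, h', h', he, hf]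
  simp only [Sym2.mem_iff, ne_eq, Sym2.eq_iff, not_or, not_and] at hne ⊢
  by_cases h1 : a = c <;> by_cases h2 : a = d <;> by_cases h3 : b = c <;> by_cases h4 : b = d <;>
    simp_all

end Incidence

section Spectrum

variable {V : Type*} [Fintype V] [DecidableEq V] (G : SimpleGraph V)

theorem posSemidef_edgeLapMatrix [Fintype G.edgeSet] : G.edgeLapMatrix.PosSemidef :=
  posSemidef_conjTranspose_mul_self _

variable [DecidableRel G.Adj]

/-- The eigenvalues of the edge Laplacian. -/
noncomputable def edgeEigenvalues : G.edgeSet → ℝ := G.posSemidef_edgeLapMatrix.1.eigenvalues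

theorem edgeEigenvalues_nonneg (e : G.edgeSet) : 0 ≤ G.edgeEigenvalues e :=
  G.posSemidef_edgeLapMatrix.eigenvalues_nonneg e

theorem sum_edgeEigenvalues : ∑ e, G.edgeEigenvalues e = #(univ : Finset G.edgeSet) * 2 := by
  have h := G.posSemidef_edgeLapMatrix.1.trace_eq_sum_eigenvalues
  simp only [RCLike.ofReal_real_eq_id, id] at h
  rw [edgeEigenvalues, ← h, trace]
  simp [edgeLapMatrix_apply_self]

theorem charpoly_edgeLapMatrix :
    G.edgeLapMatrix.charpoly = ∏ e, (X - C (G.edgeEigenvalues e)) := by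
  simpa [edgeEigenvalues] using G.posSemidef_edgeLapMatrix.1.charpoly_eq

/-- The characteristic polynomials of `B Bᵀ` and `Bᵀ B` agree up to a power of `X`; having powers on
both sides avoids comparing `m` with `n`. -/
theorem X_pow_mul_charpoly_lapMatrix :
    X ^ Fintype.card G.edgeSet * (G.lapMatrix ℝ).charpoly
      = X ^ Fintype.card V * ∏ e, (X - C (G.edgeEigenvalues e)) := by
  rw [← signedIncMatrix_mul_conjTranspose, charpoly_mul_comm', ← charpoly_edgeLapMatrix]
  rfl

theorem mem_spectrum_lapMatrix_iff {x : ℝ} (hx : x ≠ 0) :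
    x ∈ spectrum ℝ (G.lapMatrix ℝ) ↔ ∃ e, G.edgeEigenvalues e = x := by
  have h := congrArg (eval x) G.X_pow_mul_charpoly_lapMatrix
  simp only [eval_mul, eval_pow, eval_X, eval_prod, eval_sub, eval_C] at h
  rw [Matrix.mem_spectrum_iff_isRoot_charpoly, IsRoot.def,
    ← mul_right_inj' (pow_ne_zero (Fintype.card G.edgeSet) hx), h, mul_zero, mul_eq_zero,
    prod_eq_zero_iff]
  simp [hx, sub_eq_zero, @eq_comm _ x]

theorem edgeEigenvalues_eq_two (h : ∀ e f : G.edgeSet, e ≠ f → G.edgeLapMatrix e f = 0)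
    (e : G.edgeSet) : G.edgeEigenvalues e = 2 := by
  have hK : G.edgeLapMatrix = algebraMap ℝ _ 2 := by
    ext i j
    by_cases hij : i = j
    · subst hij; simp [edgeLapMatrix_apply_self, Matrix.algebraMap_matrix_apply]
    · simp [h i j hij, Matrix.algebraMap_matrix_apply, hij]
  have : Nonempty G.edgeSet := ⟨e⟩
  have hs : G.edgeEigenvalues e ∈ spectrum ℝ G.edgeLapMatrix :=
    G.posSemidef_edgeLapMatrix.1.eigenvalues_mem_spectrum_real e
  rw [hK, spectrum.scalar_eq] at hs
  exact hs

theorem edgeLapMatrix_eq_zero_of_edgeEigenvalues (h : ∀ e, G.edgeEigenvalues e = 2)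
    {e f : G.edgeSet} (hef : e ≠ f) : G.edgeLapMatrix e f = 0 := by
  have hs := G.posSemidef_edgeLapMatrix.1.spectral_theorem
  have hd : diagonal (RCLike.ofReal ∘ G.posSemidef_edgeLapMatrix.1.eigenvalues)
      = algebraMap ℝ (Matrix G.edgeSet G.edgeSet ℝ) 2 := by
    rw [Matrix.algebraMap_eq_diagonal]
    congr 1
    funext i
    exact h i
  rw [hd, AlgHomClass.commutes] at hs
  rw [hs]
  simp [Matrix.algebraMap_matrix_apply, hef]

end Spectrum

end SimpleGraph

/-! ### Coefficients and `Φ` in terms of edge eigenvalues. -/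

namespace LapPoset
open SimpleGraph Finset Polynomial

variable {V : Type*} [Fintype V] [DecidableEq V] [Nonempty V] (G : SimpleGraph V)
  [DecidableRel G.Adj]

theorem coeff_prod_X_sub_C {ι : Type*} (s : Finset ι) (μ : ι → ℝ) (k : ℕ) :
    (∏ i ∈ s, (X - C (μ i))).reverse.coeff k = (-1) ^ k * (esymmPoly s μ).coeff k := by
  classical
  induction s using Finset.induction_on generalizing k with
  | empty =>
    rw [prod_empty, ← C_1, reverse_C]
    cases k <;> simp [esymmPoly, coeff_one]
  | insert a s ha ih =>
    have hrev : (X - C (μ a)).reverse = 1 + C (-μ a) * X := by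
      rw [reverse, natDegree_X_sub_C, reflect_sub, reflect_one_X, reflect_C, pow_one, C_neg,
        neg_mul, sub_eq_add_neg]
    rw [prod_insert ha, reverse_mul_of_domain, hrev,
      esymmPoly.eq_mul_erase (mem_insert_self a s), erase_insert ha]
    cases k with
    | zero => simpa [mul_coeff_zero] using ih 0
    | succ k =>
      rw [esymmPoly.coeff_one_add_C_mul_X_mul_succ, esymmPoly.coeff_one_add_C_mul_X_mul_succ,
        ih, ih, pow_succ]
      ring

theorem lapCoeff_eq (s : ℕ) :
    lapCoeff G s = (esymmPoly univ G.edgeEigenvalues).coeff s := by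
  -- Reversal removes the powers of `X`, whose exponents differ on the two sides.
  have h := congrArg reverse G.X_pow_mul_charpoly_lapMatrix
  rw [reverse_X_pow_mul, reverse_X_pow_mul] at h
  have h' : (esymmPoly univ G.edgeEigenvalues).coeff s
      = (-1) ^ s * (lapCharpoly G).coeff (revAt (Fintype.card V) s) := by
    have hn : (lapCharpoly G).natDegree = Fintype.card V := Matrix.charpoly_natDegree_eq_dim _
    rw [← hn, ← coeff_reverse, lapCharpoly, h, coeff_prod_X_sub_C, ← mul_assoc, ← mul_pow]
    simp
  have hpos := Fintype.card_pos (α := V)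
  rw [h', lapCoeff]
  split_ifs with hs
  · rw [← X_mul_lapPoly, revAt_le hs.le,
      show Fintype.card V - s = (Fintype.card V - 1 - s) + 1 by omega, coeff_X_mul]
  · rcases eq_or_lt_of_le (not_lt.1 hs) with hs | hs
    -- At `s = n` the coefficient is the constant term, zero since `L` is singular.
    · rw [← X_mul_lapPoly, ← hs, revAt_le le_rfl, Nat.sub_self, coeff_X_mul_zero, mul_zero]
    · have : revAt (Fintype.card V) s = s := if_neg (not_le.2 hs)
      rw [this, coeff_eq_zero_of_natDegree_lt, mul_zero]
      rwa [lapCharpoly, Matrix.charpoly_natDegree_eq_dim]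

theorem lapPhi_eq {x : ℝ} (hx : x ≠ 0) :
    lapPhi G x = ∏ e, (x - G.edgeEigenvalues e) := by
  have h := congrArg (eval x) G.X_pow_mul_charpoly_lapMatrix
  have h' : eval x (G.lapMatrix ℝ).charpoly = x * (lapPoly G).eval x := by
    rw [← lapCharpoly, ← X_mul_lapPoly, eval_mul, eval_X]
  simp only [eval_mul, eval_pow, eval_X, eval_prod, eval_sub, eval_C, h'] at h
  rw [lapPhi, zpow_add₀ hx, zpow_sub₀ hx, zpow_natCast, zpow_natCast, zpow_one, edgeFinset_card]
  field_simp
  linarith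

end LapPoset

/-! ### Largest eigenvalue, matchings and their cores. -/

namespace LapPoset
open SimpleGraph Finset

theorem lapMax_ge {V : Type*} [Fintype V] [DecidableEq V] (G : SimpleGraph V) [DecidableRel G.Adj]
    (e : G.edgeSet) (he : 0 < G.edgeEigenvalues e) : G.edgeEigenvalues e ≤ lapMax G :=
  le_csSup Matrix.finite_real_spectrum.bddAbove
    ((G.mem_spectrum_lapMatrix_iff he.ne').2 ⟨e, rfl⟩)

theorem lapMax_le {V : Type*} [Fintype V] [DecidableEq V] (G : SimpleGraph V) [DecidableRel G.Adj]
    {a : ℝ} (ha : 0 ≤ a) (h : ∀ e, G.edgeEigenvalues e ≤ a) : lapMax G ≤ a := by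
  refine Real.sSup_le (fun x hx => ?_) ha
  rcases eq_or_ne x 0 with rfl | h0
  · exact ha
  · obtain ⟨e, rfl⟩ := (G.mem_spectrum_lapMatrix_iff h0).1 hx
    exact h e

theorem isGraphMatching_iff {V : Type*} [Fintype V] [DecidableEq V] (G : SimpleGraph V)
    [DecidableRel G.Adj] : IsGraphMatching G ↔ ∀ e, G.edgeEigenvalues e = 2 := by
  constructor
  · intro h
    refine G.edgeEigenvalues_eq_two fun e f hef => (edgeLapMatrix_apply_eq_zero_iff hef).2 ?_
    exact fun v he hf => hef (Subtype.ext (h e.1 e.2 f.1 f.2 v he hf))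
  · intro h e he f hf v hve hvf
    by_contra hef
    have hne : (⟨e, he⟩ : G.edgeSet) ≠ ⟨f, hf⟩ := fun h => hef (congrArg Subtype.val h)
    exact (edgeLapMatrix_apply_eq_zero_iff hne).1
      (G.edgeLapMatrix_eq_zero_of_edgeEigenvalues h hne) v hve hvf

/-- A disjoint union of edges indexed by `E`. -/
def edgeUnion (E : Type*) : SimpleGraph (E × Bool) where
  Adj p q := p.1 = q.1 ∧ p.2 ≠ q.2
  symm := ⟨fun _ _ h => ⟨h.1.symm, h.2.symm⟩⟩
  loopless := ⟨fun _ h => h.2 rfl⟩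

/-- A normal form depending only on the edge set, obtained by labelling the ends of each edge by
`Bool`. -/
theorem IsGraphMatching.nonempty_iso_edgeUnion {V : Type*} {M : SimpleGraph V}
    (hM : IsGraphMatching M) : Nonempty (edgeUnion M.edgeSet ≃g core M) := by
  have hq (e : M.edgeSet) : s((Quot.out e.1).1, (Quot.out e.1).2) = e.1 := Quot.out_eq e.1
  let c : M.edgeSet × Bool → V := fun p =>
    if p.2 then (Quot.out p.1.1).1 else (Quot.out p.1.1).2
  have hadj (e : M.edgeSet) : M.Adj (c (e, true)) (c (e, false)) := by
    rw [← mem_edgeSet]; simp [c, hq e]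
  have hmem (p : M.edgeSet × Bool) : c p ∈ p.1.1 := by
    rw [← hq p.1]; rcases p with ⟨e, _ | _⟩ <;> simp [c]
  have hadj' {p q : M.edgeSet × Bool} (h : p.1 = q.1) (h' : p.2 ≠ q.2) : M.Adj (c p) (c q) := by
    obtain ⟨e, _ | _⟩ := p <;> obtain ⟨f, _ | _⟩ := q <;> simp at h h' <;> subst h
    · exact (hadj e).symm
    · exact hadj e
  have hfst {p q : M.edgeSet × Bool} {v : V} (hp : v ∈ p.1.1) (hq : v ∈ q.1.1) : p.1 = q.1 :=
    Subtype.ext (hM _ p.1.2 _ q.1.2 v hp hq)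
  have hinj : Function.Injective c := by
    intro p q h
    have h1 : p.1 = q.1 := hfst (hmem p) (h ▸ hmem q)
    by_contra hne
    exact (hadj' h1 fun h2 => hne (Prod.ext h1 h2)).ne h
  have hsup (p : M.edgeSet × Bool) : c p ∈ M.support :=
    ⟨c (p.1, !p.2), hadj' rfl (by simp)⟩
  have hsurj (v : V) (hv : v ∈ M.support) : ∃ p, c p = v := by
    obtain ⟨w, hw⟩ := hv
    let e : M.edgeSet := ⟨s(v, w), hw⟩
    have : v ∈ s((Quot.out e.1).1, (Quot.out e.1).2) := by rw [hq e]; simp [e]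
    rcases Sym2.mem_iff.1 this with h | h
    · exact ⟨(e, true), by simp [c, ← h]⟩
    · exact ⟨(e, false), by simp [c, ← h]⟩
  refine ⟨⟨Equiv.ofBijective (fun p => (⟨c p, hsup p⟩ : M.support))
    ⟨fun p q h => hinj (congrArg Subtype.val h), fun v => ?_⟩, ?_⟩⟩
  · obtain ⟨p, hp⟩ := hsurj v.1 v.2
    exact ⟨p, Subtype.ext hp⟩
  · intro p q
    change M.Adj (c p) (c q) ↔ p.1 = q.1 ∧ p.2 ≠ q.2
    refine ⟨fun h => ?_, fun h => hadj' h.1 h.2⟩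
    have h1 : p.1.1 = s(c p, c q) := hM _ p.1.2 _ h (c p) (hmem p) (by simp)
    have h2 : q.1.1 = s(c p, c q) := hM _ q.1.2 _ h (c q) (hmem q) (by simp)
    have h3 : p.1 = q.1 := Subtype.ext (h1.trans h2.symm)
    exact ⟨h3, fun h4 => h.ne (congrArg c (Prod.ext h3 h4))⟩

theorem IsGraphMatching.nonempty_core_iso {V W : Type*} {M : SimpleGraph V} {N : SimpleGraph W}
    (hM : IsGraphMatching M) (hN : IsGraphMatching N) (e : M.edgeSet ≃ N.edgeSet) :
    Nonempty (core M ≃g core N) := by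
  obtain ⟨f⟩ := hM.nonempty_iso_edgeUnion
  obtain ⟨g⟩ := hN.nonempty_iso_edgeUnion
  let h : edgeUnion M.edgeSet ≃g edgeUnion N.edgeSet :=
    ⟨e.prodCongr (Equiv.refl Bool), by simp [edgeUnion]⟩
  exact ⟨f.symm.trans (h.trans g)⟩

end LapPoset

theorem mainTheorem3 {V : Type*} {W : Type*}
    [Fintype V] [DecidableEq V] [Fintype W] [DecidableEq W]
    (M : SimpleGraph W) [DecidableRel M.Adj] (G : SimpleGraph V) [DecidableRel G.Adj]
    (hM : LapPoset.IsGraphMatching M)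
    (hcard : G.edgeFinset.card = M.edgeFinset.card)
    (hiso : ¬ Nonempty (LapPoset.core G ≃g LapPoset.core M)) :
    (∀ s : ℕ, LapPoset.lapCoeff G s ≤ LapPoset.lapCoeff M s) ∧
    (∀ s : ℕ, 2 ≤ s → s ≤ M.edgeFinset.card →
      LapPoset.lapCoeff G s < LapPoset.lapCoeff M s) ∧
    LapPoset.PhiDominates M G := by
  open LapPoset Finset in
  rw [SimpleGraph.edgeFinset_card, SimpleGraph.edgeFinset_card] at hcard
  obtain ⟨φ⟩ := Fintype.card_eq.1 hcard
  have hG : ¬ IsGraphMatching G := fun h => hiso (h.nonempty_core_iso hM φ)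
  have hM2 := (isGraphMatching_iff M).1 hM
  rw [isGraphMatching_iff] at hG
  push Not at hG
  obtain ⟨e₀, he₀⟩ := hG
  have hne : ∃ e ∈ univ, G.edgeEigenvalues e ≠ 2 := ⟨e₀, mem_univ _, he₀⟩
  have : Nonempty V := ⟨(Quot.out e₀.1).1⟩
  have : Nonempty W := ⟨(Quot.out (φ e₀).1).1⟩
  have hsum := G.sum_edgeEigenvalues
  have hnonneg : ∀ e ∈ univ, 0 ≤ G.edgeEigenvalues e := fun e _ => G.edgeEigenvalues_nonneg e
  have hcoeff (s : ℕ) :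
      lapCoeff M s = (esymmPoly (univ : Finset G.edgeSet) fun _ => 2).coeff s := by
    rw [lapCoeff_eq, funext hM2]
    simp [esymmPoly, hcard]
  -- Mean 2 without all being 2 forces a value above 2, so every `x ≥ λ(G)` exceeds the mean, as
  -- AM-GM requires.
  obtain ⟨e₁, he₁⟩ : ∃ e, 2 < G.edgeEigenvalues e := by
    by_contra! h
    refine hsum.not_lt ((sum_lt_sum (fun e _ => h e)
      ⟨e₀, mem_univ _, (h e₀).lt_of_ne he₀⟩).trans_eq ?_)
    rw [sum_const, nsmul_eq_mul]
  have hmax : 2 < lapMax G := he₁.trans_le (lapMax_ge G e₁ (two_pos.trans he₁))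
  have hle : lapMax M ≤ lapMax G := (lapMax_le M two_pos.le fun e => (hM2 e).le).trans hmax.le
  have hlt (x : ℝ) (hx : lapMax G ≤ x) : lapPhi G x < lapPhi M x := by
    have h2 : 2 < x := hmax.trans_le hx
    have h0 : x ≠ 0 := (two_pos.trans h2).ne'
    rw [lapPhi_eq G h0, lapPhi_eq M h0]
    refine (prod_sub_lt_pow (fun e _ => ?_) h2 hsum hne).trans_eq ?_
    · rcases (G.edgeEigenvalues_nonneg e).eq_or_lt with h | h
      · rw [← h]; exact (two_pos.trans h2).le
      · exact (lapMax_ge G e h).trans hx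
    · simp [hM2, hcard]
  refine ⟨fun s => ?_, fun s h2 hs => ?_, ⟨hle, fun x hx => (hlt x hx).le⟩, hlt⟩
  · rw [lapCoeff_eq, hcoeff]
    exact esymmPoly.coeff_le_const hnonneg two_pos.le hsum s
  · rw [lapCoeff_eq, hcoeff]
    refine esymmPoly.coeff_lt_const hnonneg two_pos hsum hne h2 ?_
    rwa [card_univ, hcard, ← SimpleGraph.edgeFinset_card]
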